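/- **Theorem (Lower bound on communication cost).** Let $1<k\le n\le 2k-1$ and consider a $((k,n))$ quantum threshold secret sharing scheme for secrets of dimension $M$: a quantum operation $\mathcal E$ (completely positive trace-preserving map) encoding density matrices on $\mathbb C^M$ into joint states of $n$ shares, the share of party $i$ being a finite-dimensional system $S_i$, such that (recoverability) for every set $A$ of at least $k$ parties there is a quantum operation that recovers every secret state $\rho$ from the reduced state of $\mathcal E(\rho)$ on the shares of $A$, and (secrecy) for every set $B$ of at most $k-1$ parties the reduced state of $\mathcal E(\rho)$ on the shares of $B$ does not depend on $\rho$. Let $D\subseteq\{1,\dots,n\}$ be any set of $d\ge k$ parties, and suppose a combiner recovers the secret from the parties in $D$ as follows: each party $j\in D$ applies a quantum operation to its own share $S_j$ (for instance, discards a subsystem) and sends the resulting system, with finite-dimensional Hilbert space $H_j$, to the combiner, who then applies a quantum operation to $\bigotimes_{j\in D}H_j$ whose output is $\rho$, for every secret state $\rho$. Then the state communicated to the combiner lies in a Hilbert space of dimension at least $M^{d/(d-k+1)}$: $$\dim\bigotimes_{j\in D}H_j=\prod_{j\in D}\dim H_j\;\ge\;M^{\,d/(d-k+1)} .$$ -/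

import Mathlib

namespace QSS

open scoped ComplexOrder in
/-- A density matrix on the Hilbert space `ℂ^a`: positive semidefinite of trace one. -/
def IsDensity {a : Type*} [Fintype a] (ρ : Matrix a a ℂ) : Prop :=
  ρ.PosSemidef ∧ ρ.trace = 1

/-- `Φ` is a (deterministic) quantum operation from the system `ℂ^a` to the system `ℂ^b`:
it has an operator-sum form `Φ X = ∑ r, K r * X * (K r)ᴴ` with `∑ r, (K r)ᴴ * K r = 1`
(equivalently, it is completely positive and trace preserving). -/
def IsQuantumOperation {a b : Type*} [Fintype a] [DecidableEq a] [Fintype b]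
    (Φ : Matrix a a ℂ →ₗ[ℂ] Matrix b b ℂ) : Prop :=
  ∃ (N : ℕ) (K : Fin N → Matrix b a ℂ),
    (∀ X : Matrix a a ℂ, Φ X = ∑ r, K r * X * (K r).conjTranspose) ∧
    ∑ r, (K r).conjTranspose * K r = 1

/-- The reduced state of a joint state `X` of the systems `ℂ^(β i)`, `i : ι`, on the subsystems
indexed by `A`: the partial trace over all systems outside `A`. -/
def reducedState {ι : Type*} [Fintype ι] [DecidableEq ι] {β : ι → Type*} [∀ i, Fintype (β i)]
    (A : Finset ι) (X : Matrix (∀ i, β i) (∀ i, β i) ℂ) :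
    Matrix (∀ i : {i // i ∈ A}, β i) (∀ i : {i // i ∈ A}, β i) ℂ :=
  Matrix.of fun u v => ∑ w : (∀ i : {i // i ∉ A}, β i),
    X ((Equiv.piEquivPiSubtypeProd (fun i => i ∈ A) β).symm (u, w))
      ((Equiv.piEquivPiSubtypeProd (fun i => i ∈ A) β).symm (v, w))

/-- The tensor product `⨂ j, Φ j` of linear maps on matrix spaces, i.e. the joint map in which
`Φ j` acts on the `j`-th tensor factor. It is the linear map given on matrix units
`|x⟩⟨y| = ⨂ j, |x j⟩⟨y j|` by `⨂ j, Φ j |x j⟩⟨y j|`. -/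
def tensorOperation {ι : Type*} [Fintype ι] [DecidableEq ι] {α β : ι → Type*}
    [∀ j, Fintype (α j)] [∀ j, DecidableEq (α j)]
    (Φ : ∀ j, Matrix (α j) (α j) ℂ →ₗ[ℂ] Matrix (β j) (β j) ℂ) :
    Matrix (∀ j, α j) (∀ j, α j) ℂ →ₗ[ℂ] Matrix (∀ j, β j) (∀ j, β j) ℂ where
  toFun X := Matrix.of fun u v =>
    ∑ x, ∑ y, X x y * ∏ j, Φ j (Matrix.single (x j) (y j) 1) (u j) (v j)
  map_add' X Y := by
    ext u v
    simp [add_mul, Finset.sum_add_distrib]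
  map_smul' c X := by
    ext u v
    simp [mul_assoc, Finset.mul_sum]

/-- A `((k,n))` quantum threshold secret sharing scheme for a secret in `ℂ^M`, where the share of
party `i` is a system of dimension `s i`. The encoding `enc` may be any quantum operation
(pure state and mixed state schemes). -/
structure IsThresholdScheme (k n M : ℕ) (s : Fin n → ℕ)
    (enc : Matrix (Fin M) (Fin M) ℂ →ₗ[ℂ]
      Matrix (∀ i, Fin (s i)) (∀ i, Fin (s i)) ℂ) : Prop where
  one_lt : 1 < k
  le_parties : k ≤ n
  parties_le : n ≤ 2 * k - 1
  isQuantumOperation : IsQuantumOperation enc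
  /-- Any `k` or more parties can recover every secret state from their shares. -/
  recoverability : ∀ A : Finset (Fin n), k ≤ A.card →
    ∃ dec : Matrix (∀ i : {i // i ∈ A}, Fin (s i)) (∀ i : {i // i ∈ A}, Fin (s i)) ℂ →ₗ[ℂ]
        Matrix (Fin M) (Fin M) ℂ,
      IsQuantumOperation dec ∧
      ∀ ρ, IsDensity ρ → dec (reducedState A (enc ρ)) = ρ
  /-- The joint state of the shares of fewer than `k` parties does not depend on the secret. -/
  secrecy : ∀ B : Finset (Fin n), B.card < k →
    ∀ ρ σ, IsDensity ρ → IsDensity σ → reducedState B (enc ρ) = reducedState B (enc σ)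

/-- A procedure by which a combiner recovers the secret from the parties in `D`: each party
`j ∈ D` applies a quantum operation `loc j` to its own share and sends the resulting system, of
dimension `h j`, to the combiner, who applies the quantum operation `dec` to the systems received
and obtains the secret state. -/
structure IsRecoveryProcedure {n M : ℕ} {s : Fin n → ℕ}
    (enc : Matrix (Fin M) (Fin M) ℂ →ₗ[ℂ] Matrix (∀ i, Fin (s i)) (∀ i, Fin (s i)) ℂ)
    (D : Finset (Fin n)) (h : {j // j ∈ D} → ℕ)
    (loc : ∀ j : {j // j ∈ D}, Matrix (Fin (s j)) (Fin (s j)) ℂ →ₗ[ℂ]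
      Matrix (Fin (h j)) (Fin (h j)) ℂ)
    (dec : Matrix (∀ j, Fin (h j)) (∀ j, Fin (h j)) ℂ →ₗ[ℂ] Matrix (Fin M) (Fin M) ℂ) :
    Prop where
  loc_isQuantumOperation : ∀ j, IsQuantumOperation (loc j)
  dec_isQuantumOperation : IsQuantumOperation dec
  recovers : ∀ ρ, IsDensity ρ →
    dec (tensorOperation loc (reducedState D (enc ρ))) = ρ

end QSS

namespace QSS

open scoped ComplexOrder in
lemma isDensity_smul_vecMulVec {a : Type*} [Fintype a] (v : a → ℂ) (c : ℝ) (hc : 0 ≤ c)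
    (hv : (c : ℂ) * ∑ i, v i * star (v i) = 1) :
    IsDensity ((c : ℂ) • Matrix.vecMulVec v (star v)) := by
  refine ⟨(Matrix.posSemidef_vecMulVec_self_star v).smul (by exact_mod_cast hc), ?_⟩
  rw [Matrix.trace_smul, smul_eq_mul, ← hv]
  simp [Matrix.trace, Matrix.vecMulVec_apply]

lemma isDensity_single {a : Type*} [Fintype a] [DecidableEq a] (i : a) :
    IsDensity (Matrix.single i i (1 : ℂ)) := by
  have := isDensity_smul_vecMulVec (Pi.single i (1 : ℂ)) 1 zero_le_one (by simp [Pi.single_apply])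
  convert this using 1
  ext x y
  simp only [Matrix.smul_apply, Matrix.vecMulVec_apply, Matrix.single_apply, Pi.star_apply,
    Pi.single_apply]
  by_cases h1 : i = x <;> by_cases h2 : i = y <;> simp_all [eq_comm]

/-- Polarization: a linear map on matrices is determined by its values on density matrices. -/
lemma linearMap_ext_density {a : Type*} [Fintype a] [DecidableEq a] {V : Type*} [AddCommGroup V]
    [Module ℂ V] {f g : Matrix a a ℂ →ₗ[ℂ] V} (hfg : ∀ ρ, IsDensity ρ → f ρ = g ρ) : f = g := by
  have hdiag : ∀ i, f (Matrix.single i i 1) = g (Matrix.single i i 1) :=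
    fun i => hfg _ (isDensity_single i)
  have hoff : ∀ i j, i ≠ j → ∀ z : ℂ, z * star z = 1 →
      f (z • Matrix.single j i 1 + star z • Matrix.single i j 1)
        = g (z • Matrix.single j i 1 + star z • Matrix.single i j 1) := fun i j hij z hz => by
    have := hfg _ (isDensity_smul_vecMulVec (Pi.single i (1 : ℂ) + Pi.single j z) (1 / 2)
      (by norm_num) (by
        rw [← Finset.add_sum_erase _ _ (Finset.mem_univ i),
          ← Finset.add_sum_erase _ _ (Finset.mem_erase.2 ⟨hij.symm, Finset.mem_univ j⟩),
          Finset.sum_eq_zero]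
        · simp only [Pi.add_apply, Pi.single_eq_same, Pi.single_eq_of_ne hij,
            Pi.single_eq_of_ne hij.symm, add_zero, zero_add, star_one, hz]
          norm_num
        · intro x hx
          simp only [Finset.mem_erase] at hx
          simp [hx.1, hx.2.1]))
    have e : Matrix.vecMulVec (Pi.single i (1 : ℂ) + Pi.single j z : a → ℂ)
          (star (Pi.single i (1 : ℂ) + Pi.single j z : a → ℂ))
        = Matrix.single i i (1 : ℂ) + Matrix.single j j 1
          + (z • Matrix.single j i 1 + star z • Matrix.single i j 1) := by
      ext x y
      simp only [Matrix.add_apply, Matrix.smul_apply, Matrix.vecMulVec_apply, Matrix.single_apply,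
        Pi.star_apply, Pi.add_apply, Pi.single_apply, star_add, smul_eq_mul, eq_comm (a := x),
        eq_comm (a := y)]
      clear this hdiag hfg
      by_cases h1 : i = x <;> by_cases h2 : i = y <;> by_cases h3 : j = x <;>
        by_cases h4 : j = y <;> simp_all
    rw [e, map_smul, map_smul] at this
    have h2 := smul_right_injective V (r := (((1 / 2 : ℝ) : ℂ))) (by norm_num) this
    simpa [hdiag] using h2
  have hunit : ∀ i j, f (Matrix.single i j 1) = g (Matrix.single i j 1) := fun i j => by
    by_cases hij : i = j
    · exact hij ▸ hdiag i
    have h1 := hoff i j hij 1 (by simp)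
    have h2 := hoff i j hij Complex.I (by simp)
    have e : (Matrix.single i j 1 : Matrix a a ℂ)
        = (1 / 2 : ℂ) • ((1 : ℂ) • Matrix.single j i 1 + star (1 : ℂ) • Matrix.single i j 1)
          + (Complex.I / 2) • (Complex.I • Matrix.single j i 1
            + star Complex.I • Matrix.single i j 1) := by
      ext x y
      simp only [Matrix.add_apply, Matrix.smul_apply, smul_eq_mul, star_one, RCLike.star_def,
        Complex.conj_I]
      linear_combination (-1 / 2 * Matrix.single j i 1 x y
        + 1 / 2 * Matrix.single i j 1 x y) * Complex.I_sq
    rw [e, map_add, map_add, map_smul, map_smul, map_smul, map_smul, h1, h2]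
  refine LinearMap.ext fun X => ?_
  rw [Matrix.matrix_eq_sum_single X]
  simp only [map_sum]
  refine Finset.sum_congr rfl fun i _ => Finset.sum_congr rfl fun j _ => ?_
  rw [← mul_one (X i j), ← smul_eq_mul, ← Matrix.smul_single, map_smul, map_smul, hunit]

/-- If the output on `α × β` of the map with Kraus operators `K` can be decoded by the quantum
operation with Kraus operators `L`, while its marginal on `β` carries no information on the input,
then the dimension of the input is at most that of `α`. -/
lemma card_le_of_recovers_of_decoupled {ι κ α β m : Type*} [Fintype ι] [Fintype κ] [Fintype α]
    [DecidableEq α] [Fintype β] [DecidableEq β] [Fintype m] [DecidableEq m]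
    (L : ι → Matrix m (α × β) ℂ) (K : κ → Matrix (α × β) m ℂ) (ω : Matrix β β ℂ)
    (hL : ∑ r, (L r).conjTranspose * L r = 1)
    (hid : ∀ i j, ∑ r, ∑ s, (L r * K s) i i * star ((L r * K s) j j) = 1)
    (hω : ∀ i j b b', ∑ s, ∑ a, K s (a, b) i * star (K s (a, b') j) = if i = j then ω b b' else 0)
    (htr : ω.trace = 1) : Fintype.card m ≤ Fintype.card α := by
  let c : ι → κ → α → α → ℂ := fun r s a a' => ∑ i, ∑ b, L r i (a, b) * K s (a', b) i
  have htrace : ∀ r s, (L r * K s).trace = ∑ a, c r s a a := fun r s => by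
    simp only [Matrix.trace, Matrix.diag, Matrix.mul_apply, Fintype.sum_prod_type, c]
    exact Finset.sum_comm
  have hlow : ∑ r, ∑ s, ‖(L r * K s).trace‖ ^ 2 = (Fintype.card m : ℝ) ^ 2 := by
    have : ∑ r, ∑ s, (L r * K s).trace * star (L r * K s).trace = (Fintype.card m : ℂ) ^ 2 := by
      simp only [Matrix.trace, Matrix.diag, star_sum, Finset.sum_mul_sum]
      calc _ = ∑ i, ∑ j, ∑ r, ∑ s, (L r * K s) i i * star ((L r * K s) j j) := by
            rw [Finset.sum_congr rfl fun r _ => Finset.sum_comm, Finset.sum_comm]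
            refine Finset.sum_congr rfl fun i _ => ?_
            rw [Finset.sum_congr rfl fun r _ => Finset.sum_comm, Finset.sum_comm]
        _ = _ := by simp only [hid]; simp [sq]
    have h2 : ((∑ r, ∑ s, ‖(L r * K s).trace‖ ^ 2 : ℝ) : ℂ) = ((Fintype.card m : ℝ) ^ 2 : ℝ) := by
      push_cast
      rw [← this]
      simp [Complex.mul_conj']
    exact_mod_cast h2
  have hup : ∑ r, ∑ s, ∑ a, ∑ a', ‖c r s a a'‖ ^ 2 = (Fintype.card α : ℝ) := by
    have hK : ∀ r a, ∑ s, ∑ a', c r s a a' * star (c r s a a')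
        = ∑ b, ∑ b', (∑ i, star (L r i (a, b')) * L r i (a, b)) * ω b b' := fun r a => by
      calc _ = ∑ p : κ × α, ∑ q : m × β, ∑ q' : m × β, L r q.1 (a, q.2) * star (L r q'.1 (a, q'.2)) *
              (K p.1 (p.2, q.2) q.1 * star (K p.1 (p.2, q'.2) q'.1)) := by
            rw [Fintype.sum_prod_type]
            refine Finset.sum_congr rfl fun s _ => Finset.sum_congr rfl fun a' _ => ?_
            simp only [c]
            rw [← Fintype.sum_prod_type' (f := fun i b => L r i (a, b) * K s (a', b) i), star_sum,
              Finset.sum_mul_sum]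
            refine Finset.sum_congr rfl fun q _ => Finset.sum_congr rfl fun q' _ => ?_
            rw [star_mul']
            ring
        _ = ∑ q : m × β, ∑ q' : m × β, L r q.1 (a, q.2) * star (L r q'.1 (a, q'.2)) *
              ∑ p : κ × α, K p.1 (p.2, q.2) q.1 * star (K p.1 (p.2, q'.2) q'.1) := by
            simp only [Finset.mul_sum]
            rw [Finset.sum_comm]
            exact Finset.sum_congr rfl fun q _ => Finset.sum_comm
        _ = ∑ i, ∑ b, ∑ j, ∑ b', L r i (a, b) * star (L r j (a, b')) *
              ∑ s, ∑ a', K s (a', b) i * star (K s (a', b') j) := by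
            simp only [Fintype.sum_prod_type]
        _ = ∑ i, ∑ b, ∑ b', star (L r i (a, b')) * L r i (a, b) * ω b b' := by
            refine Finset.sum_congr rfl fun i _ => Finset.sum_congr rfl fun b _ => ?_
            rw [Finset.sum_comm]
            refine Finset.sum_congr rfl fun b' _ => ?_
            simp only [hω, mul_ite, mul_zero, Finset.sum_ite_eq, Finset.mem_univ, if_true]
            ring
        _ = _ := by
            rw [Finset.sum_comm]
            refine Finset.sum_congr rfl fun b _ => ?_
            rw [Finset.sum_comm]
            simp only [Finset.sum_mul]
    have : ∑ r, ∑ s, ∑ a, ∑ a', c r s a a' * star (c r s a a') = (Fintype.card α : ℂ) := by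
      calc _ = ∑ a, ∑ b, ∑ b', (∑ r, (L r).conjTranspose * L r) (a, b') (a, b) * ω b b' := by
            rw [Finset.sum_congr rfl fun r _ => Finset.sum_comm]
            simp only [hK]
            rw [Finset.sum_comm]
            refine Finset.sum_congr rfl fun a _ => ?_
            rw [Finset.sum_comm]
            refine Finset.sum_congr rfl fun b _ => ?_
            rw [Finset.sum_comm]
            refine Finset.sum_congr rfl fun b' _ => ?_
            rw [← Finset.sum_mul, Matrix.sum_apply]
            simp [Matrix.mul_apply]
        _ = ∑ _a : α, ω.trace := by
            refine Finset.sum_congr rfl fun a _ => Finset.sum_congr rfl fun b _ => ?_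
            simp [hL, Matrix.one_apply]
        _ = _ := by simp [htr]
    have h2 : ((∑ r, ∑ s, ∑ a, ∑ a', ‖c r s a a'‖ ^ 2 : ℝ) : ℂ) = ((Fintype.card α : ℝ) : ℂ) := by
      push_cast
      rw [← this]
      simp [Complex.mul_conj']
    exact_mod_cast h2
  have hcs : ∀ r s, ‖(L r * K s).trace‖ ^ 2
      ≤ Fintype.card α * ∑ a, ∑ a', ‖c r s a a'‖ ^ 2 := fun r s => by
    rw [htrace]
    calc _ ≤ (∑ a, ‖c r s a a‖) ^ 2 := by gcongr; exact norm_sum_le _ _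
      _ ≤ Fintype.card α * ∑ a, ‖c r s a a‖ ^ 2 := by
          simpa using sq_sum_le_card_mul_sum_sq (s := Finset.univ) (f := fun a => ‖c r s a a‖)
      _ ≤ _ := by
          gcongr with a
          exact Finset.single_le_sum (f := fun a' => ‖c r s a a'‖ ^ 2)
            (fun _ _ => by positivity) (Finset.mem_univ a)
  have : (Fintype.card m : ℝ) ^ 2 ≤ (Fintype.card α : ℝ) ^ 2 := by
    rw [← hlow, sq (Fintype.card α : ℝ)]
    nth_rw 2 [← hup]
    simp only [Finset.mul_sum] at hcs ⊢
    exact Finset.sum_le_sum fun r _ => Finset.sum_le_sum fun s _ => hcs r s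
  exact_mod_cast (pow_le_pow_iff_left₀ (by positivity) (by positivity) two_ne_zero).1 this

/-- Maps with an operator-sum form, i.e. completely positive maps. -/
def HasKrausForm {a b : Type} [Fintype a] [Fintype b]
    (Φ : Matrix a a ℂ →ₗ[ℂ] Matrix b b ℂ) : Prop :=
  ∃ (ι : Type) (_ : Fintype ι) (K : ι → Matrix b a ℂ),
    ∀ X : Matrix a a ℂ, Φ X = ∑ r, K r * X * (K r).conjTranspose

lemma IsQuantumOperation.hasKrausForm {a b : Type} [Fintype a] [DecidableEq a] [Fintype b]
    {Φ : Matrix a a ℂ →ₗ[ℂ] Matrix b b ℂ} (hΦ : IsQuantumOperation Φ) : HasKrausForm Φ :=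
  let ⟨N, K, hK, _⟩ := hΦ
  ⟨Fin N, inferInstance, K, hK⟩

lemma IsQuantumOperation.trace_apply {a b : Type*} [Fintype a] [DecidableEq a] [Fintype b]
    {Φ : Matrix a a ℂ →ₗ[ℂ] Matrix b b ℂ} (hΦ : IsQuantumOperation Φ) (X : Matrix a a ℂ) :
    (Φ X).trace = X.trace := by
  obtain ⟨N, K, hK, hK1⟩ := hΦ
  rw [hK, Matrix.trace_sum]
  calc _ = ∑ r, (((K r).conjTranspose * K r) * X).trace := by
        refine Finset.sum_congr rfl fun r _ => ?_
        rw [Matrix.trace_mul_comm, Matrix.mul_assoc]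
    _ = _ := by rw [← Matrix.trace_sum, ← Finset.sum_mul, hK1, one_mul]

lemma HasKrausForm.comp {a b c : Type} [Fintype a] [Fintype b] [Fintype c]
    {Ψ : Matrix b b ℂ →ₗ[ℂ] Matrix c c ℂ} {Φ : Matrix a a ℂ →ₗ[ℂ] Matrix b b ℂ}
    (hΨ : HasKrausForm Ψ) (hΦ : HasKrausForm Φ) : HasKrausForm (Ψ ∘ₗ Φ) := by
  obtain ⟨ι, _, K, hK⟩ := hΨ
  obtain ⟨κ, _, J, hJ⟩ := hΦ
  refine ⟨ι × κ, inferInstance, fun p => K p.1 * J p.2, fun X => ?_⟩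
  rw [LinearMap.comp_apply, hK, Fintype.sum_prod_type]
  simp only [hJ, Matrix.mul_sum, Matrix.sum_mul, Matrix.conjTranspose_mul, Matrix.mul_assoc]

/-- The partial trace as a linear map. -/
def reducedStateLM {ι : Type*} [Fintype ι] [DecidableEq ι] {β : ι → Type*} [∀ i, Fintype (β i)]
    (A : Finset ι) : Matrix (∀ i, β i) (∀ i, β i) ℂ →ₗ[ℂ]
      Matrix (∀ i : {i // i ∈ A}, β i) (∀ i : {i // i ∈ A}, β i) ℂ where
  toFun := reducedState A
  map_add' X Y := by
    ext u v
    simp [reducedState, Finset.sum_add_distrib]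
  map_smul' c X := by
    ext u v
    simp [reducedState, Finset.mul_sum]

@[simp]
lemma reducedStateLM_apply {ι : Type*} [Fintype ι] [DecidableEq ι] {β : ι → Type*}
    [∀ i, Fintype (β i)] (A : Finset ι) (X : Matrix (∀ i, β i) (∀ i, β i) ℂ) :
    reducedStateLM A X = reducedState A X := rfl

lemma hasKrausForm_reducedStateLM {ι : Type} [Fintype ι] [DecidableEq ι] {β : ι → Type}
    [∀ i, Fintype (β i)] [∀ i, DecidableEq (β i)] (A : Finset ι) :
    HasKrausForm (reducedStateLM (β := β) A) := by
  refine ⟨∀ i : {i // i ∉ A}, β i, inferInstance, fun w => Matrix.of fun u x =>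
    if x = (Equiv.piEquivPiSubtypeProd (fun i => i ∈ A) β).symm (u, w) then 1 else 0,
    fun X => ?_⟩
  ext u v
  simp [reducedState, Matrix.sum_apply, Matrix.mul_apply]

lemma hasKrausForm_tensorOperation {ι : Type} [Fintype ι] [DecidableEq ι] {α β : ι → Type}
    [∀ j, Fintype (α j)] [∀ j, DecidableEq (α j)] [∀ j, Fintype (β j)]
    {Φ : ∀ j, Matrix (α j) (α j) ℂ →ₗ[ℂ] Matrix (β j) (β j) ℂ} (hΦ : ∀ j, HasKrausForm (Φ j)) :
    HasKrausForm (tensorOperation Φ) := by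
  choose κ _ K hK using hΦ
  refine ⟨∀ j, κ j, inferInstance, fun f => Matrix.of fun u x => ∏ j, K j (f j) (u j) (x j),
    fun X => ?_⟩
  ext u v
  have hentry : ∀ (x y : ∀ j, α j) j, Φ j (Matrix.single (x j) (y j) 1) (u j) (v j)
      = ∑ r, K j r (u j) (x j) * star (K j r (v j) (y j)) := fun x y j => by
    rw [hK, Matrix.sum_apply]
    refine Finset.sum_congr rfl fun r _ => ?_
    simp [Matrix.mul_apply, Matrix.single_apply, ite_and]
  simp only [tensorOperation, LinearMap.coe_mk, AddHom.coe_mk, Matrix.of_apply, hentry]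
  have hprod : ∀ x y : ∀ j, α j, ∏ j, ∑ r, K j r (u j) (x j) * star (K j r (v j) (y j))
      = ∑ f : ∀ j, κ j, (∏ j, K j (f j) (u j) (x j)) * star (∏ j, K j (f j) (v j) (y j)) :=
    fun x y => by
      classical
      rw [Finset.prod_univ_sum, Fintype.piFinset_univ]
      simp only [Finset.prod_mul_distrib, star_prod]
  simp only [hprod, Matrix.sum_apply, Matrix.mul_apply, Matrix.of_apply,
    Matrix.conjTranspose_apply, Finset.mul_sum, Finset.sum_mul]
  symm
  rw [Finset.sum_comm]
  refine (Finset.sum_congr rfl fun y _ => Finset.sum_comm).trans ?_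
  rw [Finset.sum_comm]
  refine Finset.sum_congr rfl fun x _ => Finset.sum_congr rfl fun y _ =>
    Finset.sum_congr rfl fun f _ => ?_
  ring

/-- Pairing a reduced state with a test function. -/
lemma sum_sum_reducedState_mul {ι : Type*} [Fintype ι] [DecidableEq ι] {β : ι → Type*}
    [∀ i, Fintype (β i)] [∀ i, DecidableEq (β i)] (A : Finset ι)
    (X : Matrix (∀ i, β i) (∀ i, β i) ℂ)
    (G : (∀ i : {i // i ∈ A}, β i) → (∀ i : {i // i ∈ A}, β i) → ℂ) :
    ∑ u, ∑ v, reducedState A X u v * G u v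
      = ∑ x, ∑ y, X x y * ((if ∀ i, i ∉ A → x i = y i then 1 else 0)
          * G (fun i => x i) (fun i => y i)) := by
  let e := Equiv.piEquivPiSubtypeProd (fun i => i ∈ A) β
  rw [← e.symm.sum_comp, Fintype.sum_prod_type]
  refine Finset.sum_congr rfl fun u _ => ?_
  have hy : ∀ f : (∀ i, β i) → ℂ, ∑ y, f y = ∑ v, ∑ w, f (e.symm (v, w)) := fun f => by
    rw [← e.symm.sum_comp, Fintype.sum_prod_type]
  simp only [hy]
  rw [Finset.sum_comm (γ := ∀ i : {i // i ∉ A}, β i)]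
  refine Finset.sum_congr rfl fun v _ => ?_
  simp only [reducedState, Matrix.of_apply, Finset.sum_mul]
  refine Finset.sum_congr rfl fun w _ => ?_
  have hcond : ∀ w', (∀ i, i ∉ A → e.symm (u, w) i = e.symm (v, w') i) ↔ w = w' := fun w' => by
    constructor
    · intro h
      ext ⟨i, hi⟩
      simpa [e, Equiv.piEquivPiSubtypeProd, hi] using congrArg (fun z => z) (h i hi)
    · rintro rfl i hi
      simp [e, Equiv.piEquivPiSubtypeProd, hi]
  have hres : ∀ (u : ∀ i : {i // i ∈ A}, β i) w', (fun i : {i // i ∈ A} => e.symm (u, w') i) = u :=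
    fun u w' => by
      ext ⟨i, hi⟩
      simp [e, Equiv.piEquivPiSubtypeProd, hi]
  simp only [hcond, hres, ite_mul, one_mul, zero_mul, mul_ite, mul_zero, Finset.sum_ite_eq,
    Finset.mem_univ, if_true]
  rfl

/-- A multiplicative averaging over the cyclic windows of length `m`: if the product of `h` over
every set of `m` indices is at least `M`, then `M ^ d ≤ (∏ h) ^ m`. -/
lemma pow_card_le_prod_pow {ι : Type*} [Fintype ι] [DecidableEq ι] (h : ι → ℕ) (M m : ℕ)
    (hm : m ≤ Fintype.card ι)
    (hM : ∀ A : Finset ι, A.card = m → M ≤ ∏ j ∈ A, h j) :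
    M ^ Fintype.card ι ≤ (∏ j, h j) ^ m := by
  rcases Nat.eq_zero_or_pos (Fintype.card ι) with h0 | hpos
  · simp [h0, Nat.le_zero.1 (h0 ▸ hm)]
  have : NeZero (Fintype.card ι) := ⟨hpos.ne'⟩
  let e : ZMod (Fintype.card ι) ≃ ι := Fintype.equivOfCardEq (ZMod.card _)
  have hwin : ∀ i, M ≤ ∏ t ∈ Finset.range m, h (e (i + t)) := fun i => by
    have hinj : Set.InjOn (fun t : ℕ => e (i + t)) (Finset.range m) := fun t ht u hu htu => by
      have := add_left_cancel (e.injective htu)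
      rw [ZMod.natCast_eq_natCast_iff'] at this
      simp only [Finset.coe_range, Set.mem_Iio] at ht hu
      rwa [Nat.mod_eq_of_lt (ht.trans_le hm), Nat.mod_eq_of_lt (hu.trans_le hm)] at this
    have := hM ((Finset.range m).image fun t : ℕ => e (i + t))
      (by rw [Finset.card_image_of_injOn hinj, Finset.card_range])
    rwa [Finset.prod_image hinj] at this
  calc M ^ Fintype.card ι = ∏ _i : ZMod (Fintype.card ι), M := by simp [ZMod.card]
    _ ≤ ∏ i : ZMod (Fintype.card ι), ∏ t ∈ Finset.range m, h (e (i + t)) :=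
        Finset.prod_le_prod' fun i _ => hwin i
    _ = ∏ t ∈ Finset.range m, ∏ j, h j := by
        rw [Finset.prod_comm]
        exact Finset.prod_congr rfl fun t _ =>
          Equiv.prod_comp ((Equiv.addRight (t : ZMod (Fintype.card ι))).trans e) h
    _ = _ := by simp

lemma trace_reducedState {ι : Type*} [Fintype ι] [DecidableEq ι] {β : ι → Type*}
    [∀ i, Fintype (β i)] (A : Finset ι) (X : Matrix (∀ i, β i) (∀ i, β i) ℂ) :
    (reducedState A X).trace = X.trace := by
  simp only [Matrix.trace, Matrix.diag, reducedState, Matrix.of_apply]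
  rw [← Fintype.sum_prod_type']
  exact (Equiv.piEquivPiSubtypeProd (fun i => i ∈ A) β).symm.sum_comp fun x => X x x

/-- The marginal on `C` of a product of trace-preserving maps only involves the maps on `C`. -/
lemma reducedState_tensorOperation_apply {ι : Type*} [Fintype ι] [DecidableEq ι]
    {α β : ι → Type*} [∀ j, Fintype (α j)] [∀ j, DecidableEq (α j)] [∀ j, Fintype (β j)]
    {Φ : ∀ j, Matrix (α j) (α j) ℂ →ₗ[ℂ] Matrix (β j) (β j) ℂ}
    (hΦ : ∀ j X, (Φ j X).trace = X.trace) (C : Finset ι)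
    (X : Matrix (∀ j, α j) (∀ j, α j) ℂ) (u v : ∀ j : {j // j ∈ C}, β j) :
    reducedState C (tensorOperation Φ X) u v
      = ∑ x, ∑ y, X x y * ((if ∀ j, j ∉ C → x j = y j then 1 else 0)
          * ∏ j : {j // j ∈ C}, Φ j (Matrix.single (x j) (y j) 1) (u j) (v j)) := by
  let e := Equiv.piEquivPiSubtypeProd (fun i => i ∈ C) β
  simp only [reducedState, tensorOperation, LinearMap.coe_mk, AddHom.coe_mk, Matrix.of_apply]
  rw [Finset.sum_comm]
  refine Finset.sum_congr rfl fun x _ => ?_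
  rw [Finset.sum_comm]
  refine Finset.sum_congr rfl fun y _ => ?_
  rw [← Finset.mul_sum]
  congr 1
  have hsplit : ∀ w, ∏ j, Φ j (Matrix.single (x j) (y j) 1) (e.symm (u, w) j) (e.symm (v, w) j)
      = (∏ j : {j // j ∈ C}, Φ j (Matrix.single (x j) (y j) 1) (u j) (v j))
        * ∏ j : {j // j ∉ C}, Φ j (Matrix.single (x j) (y j) 1) (w j) (w j) := fun w => by
    rw [← Fintype.prod_subtype_mul_prod_subtype (fun j => j ∈ C)]
    congr 1
    · refine Finset.prod_congr (by ext; simp) fun j _ => ?_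
      simp [e, Equiv.piEquivPiSubtypeProd]
    · refine Finset.prod_congr rfl fun j _ => ?_
      simp [e, Equiv.piEquivPiSubtypeProd, j.2]
  have htr : ∀ j, ∑ t, Φ j (Matrix.single (x j) (y j) 1) t t = if x j = y j then 1 else 0 :=
    fun j => by
      refine (hΦ j _).trans ?_
      split_ifs with h
      · rw [h, Matrix.trace_single_eq_same]
      · exact Matrix.trace_single_eq_of_ne _ _ _ h
  refine (Finset.sum_congr rfl fun w _ => hsplit w).trans ?_
  rw [← Finset.mul_sum, mul_comm]
  congr 1
  have := Finset.prod_univ_sum (fun j : {j // j ∉ C} => (Finset.univ : Finset (β j)))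
    (fun j t => Φ j (Matrix.single (x j) (y j) 1) t t)
  rw [Fintype.piFinset_univ] at this
  rw [← this]
  simp only [htr, Finset.prod_ite_zero, Finset.prod_const_one]
  simp

lemma reducedState_tensorOperation_reducedState_congr {n : ℕ} {s : Fin n → ℕ}
    {D : Finset (Fin n)} {h : {j // j ∈ D} → ℕ}
    {loc : ∀ j : {j // j ∈ D}, Matrix (Fin (s j)) (Fin (s j)) ℂ →ₗ[ℂ]
      Matrix (Fin (h j)) (Fin (h j)) ℂ}
    (hloc : ∀ j X, (loc j X).trace = X.trace) (C : Finset {j // j ∈ D})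
    {Y Z : Matrix (∀ i, Fin (s i)) (∀ i, Fin (s i)) ℂ}
    (hYZ : reducedState (C.map (Function.Embedding.subtype _)) Y
      = reducedState (C.map (Function.Embedding.subtype _)) Z) :
    reducedState C (tensorOperation loc (reducedState D Y))
      = reducedState C (tensorOperation loc (reducedState D Z)) := by
  have key : ∀ Y : Matrix (∀ i, Fin (s i)) (∀ i, Fin (s i)) ℂ, ∀ u v,
      reducedState C (tensorOperation loc (reducedState D Y)) u v
        = ∑ x, ∑ y, reducedState (C.map (Function.Embedding.subtype _)) Y x y
          * ∏ j : {j // j ∈ C},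
            loc j (Matrix.single (x ⟨j.1.1, Finset.mem_map_of_mem _ j.2⟩)
              (y ⟨j.1.1, Finset.mem_map_of_mem _ j.2⟩) 1) (u j) (v j) := fun Y u v => by
    rw [reducedState_tensorOperation_apply hloc, sum_sum_reducedState_mul D Y,
      sum_sum_reducedState_mul _ Y]
    refine Finset.sum_congr rfl fun x _ => Finset.sum_congr rfl fun y _ => ?_
    have hiff : ((∀ i, i ∉ D → x i = y i) ∧ ∀ j : {j // j ∈ D}, j ∉ C → x j = y j) ↔
        ∀ i, i ∉ C.map (Function.Embedding.subtype _) → x i = y i := by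
      constructor
      · rintro ⟨h1, h2⟩ i hi
        by_cases hD : i ∈ D
        · exact h2 ⟨i, hD⟩ fun hC => hi (Finset.mem_map_of_mem _ hC)
        · exact h1 i hD
      · intro h1
        exact ⟨fun i hi => h1 i fun hC => hi (by simp at hC; exact hC.1),
          fun j hj => h1 j fun hC => hj (by simpa using hC)⟩
    by_cases h1 : ∀ i, i ∉ D → x i = y i <;>
      by_cases h2 : ∀ j : {j // j ∈ D}, j ∉ C → x j = y j
    · rw [if_pos h1, if_pos h2, if_pos (hiff.1 ⟨h1, h2⟩), one_mul]
    · rw [if_pos h1, if_neg h2, if_neg fun hB => h2 (hiff.2 hB).2, one_mul]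
    all_goals rw [if_neg h1, if_neg fun hB => h1 (hiff.2 hB).1, zero_mul, zero_mul]
  ext u v
  rw [key, key, hYZ]

lemma mul_single_mul_conjTranspose_apply {a b : Type*} [Fintype a] [DecidableEq a]
    (A : Matrix b a ℂ) (i j : a) (x y : b) :
    (A * Matrix.single i j (1 : ℂ) * A.conjTranspose) x y = A x i * star (A y j) := by
  simp [Matrix.mul_apply, Matrix.single_apply, ite_and]

/-- The systems sent by all but `k - 1` of the parties have total dimension at least `M`. -/
lemma le_prod_compl_of_card_lt {k n M : ℕ} {s : Fin n → ℕ}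
    {enc : Matrix (Fin M) (Fin M) ℂ →ₗ[ℂ] Matrix (∀ i, Fin (s i)) (∀ i, Fin (s i)) ℂ}
    (hscheme : IsThresholdScheme k n M s enc) {D : Finset (Fin n)} {h : {j // j ∈ D} → ℕ}
    {loc : ∀ j : {j // j ∈ D}, Matrix (Fin (s j)) (Fin (s j)) ℂ →ₗ[ℂ]
      Matrix (Fin (h j)) (Fin (h j)) ℂ}
    {dec : Matrix (∀ j, Fin (h j)) (∀ j, Fin (h j)) ℂ →ₗ[ℂ] Matrix (Fin M) (Fin M) ℂ}
    (hrec : IsRecoveryProcedure enc D h loc dec) (C : Finset {j // j ∈ D}) (hC : C.card < k) :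
    M ≤ ∏ j ∈ Cᶜ, h j := by
  rcases Nat.eq_zero_or_pos M with rfl | hM
  · exact Nat.zero_le _
  let e : (∀ j : {j // j ∉ C}, Fin (h j)) × (∀ j : {j // j ∈ C}, Fin (h j)) ≃ ∀ j, Fin (h j) :=
    (Equiv.prodComm _ _).trans (Equiv.piEquivPiSubtypeProd (fun j => j ∈ C) fun j => Fin (h j)).symm
  let Φ := tensorOperation loc ∘ₗ reducedStateLM D ∘ₗ enc
  have hloc : ∀ j X, (loc j X).trace = X.trace :=
    fun j => (hrec.loc_isQuantumOperation j).trace_apply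
  have hid : dec ∘ₗ Φ = LinearMap.id := linearMap_ext_density hrec.recovers
  have hΦtr : ∀ X, (Φ X).trace = X.trace := fun X => by
    rw [← hrec.dec_isQuantumOperation.trace_apply, ← LinearMap.comp_apply, hid, LinearMap.id_apply]
  let ρ₀ : Matrix (Fin M) (Fin M) ℂ := Matrix.single ⟨0, hM⟩ ⟨0, hM⟩ 1
  have hρ₀ : IsDensity ρ₀ := isDensity_single _
  let ω := reducedState C (Φ ρ₀)
  have hsec : reducedStateLM C ∘ₗ Φ = (Matrix.traceLinearMap (Fin M) ℂ ℂ).smulRight ω :=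
    linearMap_ext_density fun ρ hρ => by
      rw [LinearMap.smulRight_apply, Matrix.traceLinearMap_apply, hρ.2, one_smul]
      exact reducedState_tensorOperation_reducedState_congr hloc C
        (hscheme.secrecy _ (by rwa [Finset.card_map]) ρ ρ₀ hρ hρ₀)
  obtain ⟨κ, _, K, hK⟩ : HasKrausForm Φ :=
    (hasKrausForm_tensorOperation fun j => (hrec.loc_isQuantumOperation j).hasKrausForm).comp
      ((hasKrausForm_reducedStateLM D).comp hscheme.isQuantumOperation.hasKrausForm)
  obtain ⟨N, L, hL, hL1⟩ := hrec.dec_isQuantumOperation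
  have hcard := card_le_of_recovers_of_decoupled
    (fun r => (L r).submatrix id e) (fun s => (K s).submatrix e id) ω ?_ ?_ ?_ ?_
  · rw [Fintype.card_fin, Fintype.card_pi] at hcard
    simp only [Fintype.card_fin] at hcard
    refine hcard.trans_eq ?_
    exact (Finset.prod_subtype Cᶜ (by simp) h).symm
  · ext p q
    have := congrFun (congrFun hL1 (e p)) (e q)
    simpa [Matrix.sum_apply, Matrix.mul_apply, Matrix.one_apply] using this
  · intro i j
    have := congrFun (congrFun (LinearMap.congr_fun hid (Matrix.single i j 1)) i) j
    rw [LinearMap.comp_apply, hK, hL, Matrix.sum_apply, LinearMap.id_apply,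
      Matrix.single_apply_same] at this
    refine Eq.trans (Finset.sum_congr rfl fun r _ => ?_) this
    rw [Matrix.mul_sum, Matrix.sum_mul, Matrix.sum_apply]
    refine Finset.sum_congr rfl fun s _ => ?_
    rw [Matrix.submatrix_mul_equiv, Matrix.submatrix_id_id, ← mul_single_mul_conjTranspose_apply,
      Matrix.conjTranspose_mul]
    simp only [Matrix.mul_assoc]
  · intro i j b b'
    have := congrFun (congrFun (LinearMap.congr_fun hsec (Matrix.single i j 1)) b) b'
    have htr : (if i = j then ω b b' else 0)
        = ((Matrix.traceLinearMap (Fin M) ℂ ℂ).smulRight ω) (Matrix.single i j 1) b b' := by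
      rw [LinearMap.smulRight_apply, Matrix.traceLinearMap_apply]
      split_ifs with hij
      · simp [hij]
      · simp [Matrix.trace_single_eq_of_ne _ _ _ hij]
    rw [htr, ← this, LinearMap.comp_apply, hK, Finset.sum_comm]
    refine Finset.sum_congr rfl fun a _ => ?_
    rw [Matrix.sum_apply]
    exact Finset.sum_congr rfl fun s _ => (mul_single_mul_conjTranspose_apply _ _ _ _ _).symm
  · rw [trace_reducedState, hΦtr]
    exact hρ₀.2

end QSS

theorem mainTheorem3 (k n M : ℕ) (s : Fin n → ℕ)
    (enc : Matrix (Fin M) (Fin M) ℂ →ₗ[ℂ] Matrix (∀ i, Fin (s i)) (∀ i, Fin (s i)) ℂ)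
    (hscheme : QSS.IsThresholdScheme k n M s enc)
    (d : ℕ) (hkd : k ≤ d) (D : Finset (Fin n)) (hD : D.card = d)
    (h : {j // j ∈ D} → ℕ)
    (loc : ∀ j : {j // j ∈ D}, Matrix (Fin (s j)) (Fin (s j)) ℂ →ₗ[ℂ]
      Matrix (Fin (h j)) (Fin (h j)) ℂ)
    (dec : Matrix (∀ j, Fin (h j)) (∀ j, Fin (h j)) ℂ →ₗ[ℂ] Matrix (Fin M) (Fin M) ℂ)
    (hrec : QSS.IsRecoveryProcedure enc D h loc dec) :
    (M : ℝ) ^ ((d : ℝ) / ((d : ℝ) - (k : ℝ) + 1)) ≤ ∏ j, (h j : ℝ) := by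
  have hk := hscheme.one_lt
  have hcard : Fintype.card {j // j ∈ D} = d := by rw [Fintype.card_coe, hD]
  have hpow := QSS.pow_card_le_prod_pow h M (d - k + 1) (by omega) fun A hA => by
    have := QSS.le_prod_compl_of_card_lt hscheme hrec Aᶜ (by rw [Finset.card_compl]; omega)
    rwa [compl_compl] at this
  rw [hcard] at hpow
  have hpow' : (M : ℝ) ^ d ≤ (∏ j, (h j : ℝ)) ^ (d - k + 1) := by exact_mod_cast hpow
  have hm : ((d - k + 1 : ℕ) : ℝ) = (d : ℝ) - k + 1 := by push_cast [Nat.cast_sub hkd]; ring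
  have hprod : 0 ≤ ∏ j, (h j : ℝ) := Finset.prod_nonneg fun j _ => Nat.cast_nonneg _
  rw [← hm, div_eq_mul_inv, Real.rpow_mul (Nat.cast_nonneg _), Real.rpow_natCast]
  calc _ ≤ ((∏ j, (h j : ℝ)) ^ (d - k + 1)) ^ (((d - k + 1 : ℕ) : ℝ)⁻¹) := by gcongr
    _ = _ := Real.pow_rpow_inv_natCast hprod (by omega)
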